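/- **Theorem 1.1 (Kolmogorov's and Yaglom's theorems).** Let $\mu$ be a probability distribution on $\mathbb N_0=\{0,1,2,\dots\}$ with mean $\sum_{k\ge 0} k\,\mu(k)=1$ and finite, strictly positive variance $\sigma^2=\sum_{k\ge 0}(k-1)^2\mu(k)\in(0,\infty)$. Let $(Z_n)_{n\ge 0}$ be a Galton–Watson process with offspring distribution $\mu$ and $Z_0=1$ almost surely, i.e. a Markov chain on $\mathbb N_0$ with transition probabilities $p(i,j)=\mu^{*i}(j)$, where $\mu^{*i}$ denotes the $i$-fold convolution of $\mu$ (and $\mu^{*0}=\delta_0$). Let $Y$ be an exponential random variable with mean $\sigma^2/2$. Then 1. $n\,P(Z_n>0)\to 2/\sigma^2$ as $n\to\infty$; 2. $P(Z_n>0)>0$ for every $n$, and the law of $Z_n/n$ under the conditional probability $P(\,\cdot\mid Z_n>0)$ converges in distribution (weakly) to the law of $Y$ as $n\to\infty$. -/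

import Mathlib

open MeasureTheory ProbabilityTheory Filter Topology

/-- The `k`-fold convolution `μ^{*k}` of a probability distribution `μ` on `ℕ`: the law of the sum
of `k` independent random variables with law `μ` (the point mass at `0` for `k = 0`). -/
noncomputable def convPow (μ : PMF ℕ) : ℕ → PMF ℕ
  | 0 => PMF.pure 0
  | k + 1 => (convPow μ k).bind fun a => μ.map fun b => a + b

/-- `Z` is, under the probability measure `P`, a Galton-Watson process with offspring
distribution `μ`, started from one particle: a Markov chain on `ℕ` with `Z 0 = 1` almost surely
and transition probabilities `p(i, j) = μ^{*i}(j)` (each of the `i` particles alive gives birth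
independently to a number of children with law `μ`). -/
structure IsGaltonWatson {Ω : Type*} [MeasurableSpace Ω] (μ : PMF ℕ) (Z : ℕ → Ω → ℕ)
    (P : Measure Ω) : Prop where
  measurable : ∀ n, Measurable (Z n)
  init : ∀ᵐ ω ∂P, Z 0 ω = 1
  step : ∀ (n : ℕ) (z : ℕ → ℕ),
    P {ω | ∀ m ≤ n + 1, Z m ω = z m} =
      P {ω | ∀ m ≤ n, Z m ω = z m} * convPow μ (z n) (z (n + 1))

/-!
Write `f` for the generating function of `μ` and `fₙ` for its `n`-th iterate. Summing the path
probabilities shows that `E[s ^ Z n] = fₙ(s)` for complex `s` with `‖s‖ ≤ 1`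
(`IsGaltonWatson.integral_pow`), so that `P(Z n > 0) = 1 - fₙ(0)` and
`E[s ^ Z n | Z n > 0] = 1 - (1 - fₙ(s)) / (1 - fₙ(0))`.

The two moment conditions give `f(s) = s + (s - 1)² G(s)` with `G` continuous on the closed unit
disc and `G(1) = σ² / 2`. Hence `1 / (1 - f(s)) - 1 / (1 - s)` tends to `σ² / 2` as `s → 1` in the
disc (`tendsto_invIncrement`), and telescoping along an orbit that is close to `1` yields
`1 / (1 - fₙ(s)) = 1 / (1 - s) + n σ² / 2 + o(n)`. Two orbits matter:

* `s = 0`, whose orbit tends to `1` by almost sure extinction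
  (`iterate_genFun_zero_ne_one_and_tendsto`); this is the asymptotics of the survival probability;
* `s = exp(i t / n)`, whose orbit stays within distance `‖1 - s‖` of `1` because `μ` has mean one
  (`norm_one_sub_iterate_genFun_le`); here `1 / (n (1 - s)) → 1 / (-i t)`, and the characteristic
  function of `Z n / n` given survival tends to that of the exponential law with mean `σ² / 2`.

Lévy's continuity theorem turns the second limit into convergence in distribution.
-/

/-! ### Generating functions of distributions on `ℕ` -/

/-- The probability generating function `s ↦ ∑ ν(k) s ^ k` of a distribution `ν` on `ℕ`, as a
function of a complex variable. It is only meaningful for `‖s‖ ≤ 1`, where the series converges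
absolutely. -/
noncomputable def genFun (ν : PMF ℕ) (s : ℂ) : ℂ := ∑' k, ((ν k).toReal : ℂ) * s ^ k

lemma PMF.hasSum_toReal (ν : PMF ℕ) : HasSum (fun k => (ν k).toReal) 1 := by
  have h := ENNReal.hasSum_toReal (f := fun k => ν k) (by simp [ν.tsum_coe])
  rwa [← ENNReal.tsum_toReal_eq (fun k => ν.apply_ne_top k), ν.tsum_coe, ENNReal.toReal_one] at h

lemma PMF.summable_toReal_mul (ν : PMF ℕ) {φ : ℕ → ℂ} (hφ : ∀ k, ‖φ k‖ ≤ 1) :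
    Summable fun k => ((ν k).toReal : ℂ) * φ k := by
  refine .of_norm_bounded ν.hasSum_toReal.summable fun k => ?_
  rw [norm_mul, Complex.norm_real, Real.norm_of_nonneg ENNReal.toReal_nonneg]
  exact mul_le_of_le_one_right ENNReal.toReal_nonneg (hφ k)

lemma norm_pow_le_one_of_le {s : ℂ} (hs : ‖s‖ ≤ 1) (k : ℕ) : ‖s ^ k‖ ≤ 1 := by
  rw [norm_pow]
  exact pow_le_one₀ (norm_nonneg _) hs

lemma norm_tsum_toReal_mul_le (ν : PMF ℕ) {φ : ℕ → ℂ} (hφ : ∀ k, ‖φ k‖ ≤ 1) :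
    ‖∑' k, ((ν k).toReal : ℂ) * φ k‖ ≤ 1 := by
  refine tsum_of_norm_bounded ν.hasSum_toReal fun k => ?_
  rw [norm_mul, Complex.norm_real, Real.norm_of_nonneg ENNReal.toReal_nonneg]
  exact mul_le_of_le_one_right ENNReal.toReal_nonneg (hφ k)

lemma norm_genFun_le_one (ν : PMF ℕ) {s : ℂ} (hs : ‖s‖ ≤ 1) : ‖genFun ν s‖ ≤ 1 :=
  norm_tsum_toReal_mul_le ν (norm_pow_le_one_of_le hs)

lemma tsum_pure_toReal_mul (a : ℕ) (φ : ℕ → ℂ) :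
    ∑' k, ((PMF.pure a k).toReal : ℂ) * φ k = φ a := by
  rw [tsum_eq_single a]
  · simp
  · intro b hb
    simp [hb]

/-- Expectations of bounded functions under a mixture `ν.bind κ` are iterated expectations. -/
lemma tsum_bind_toReal_mul (ν : PMF ℕ) (κ : ℕ → PMF ℕ) {φ : ℕ → ℂ} (hφ : ∀ k, ‖φ k‖ ≤ 1) :
    ∑' j, ((ν.bind κ j).toReal : ℂ) * φ j =
      ∑' i, ((ν i).toReal : ℂ) * ∑' j, ((κ i j).toReal : ℂ) * φ j := by
  have hs : Summable fun p : ℕ × ℕ => (ν p.1 * κ p.1 p.2).toReal := by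
    refine ENNReal.summable_toReal ?_
    rw [ENNReal.tsum_prod (f := fun i j => ν i * κ i j)]
    simp [ENNReal.tsum_mul_left, PMF.tsum_coe]
  have hs' : Summable (Function.uncurry fun i j : ℕ =>
      ((ν i).toReal : ℂ) * (((κ i j).toReal : ℂ) * φ j)) := by
    refine .of_norm_bounded hs fun p => ?_
    simp only [Function.uncurry, norm_mul, Complex.norm_real, ENNReal.toReal_mul,
      Real.norm_of_nonneg ENNReal.toReal_nonneg]
    rw [← mul_assoc]
    exact mul_le_of_le_one_right (by positivity) (hφ _)
  simp_rw [← tsum_mul_left]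
  rw [← hs'.tsum_comm]
  refine tsum_congr fun j => ?_
  rw [PMF.bind_apply, ENNReal.tsum_toReal_eq
    (fun i => ENNReal.mul_ne_top (ν.apply_ne_top i) ((κ i).apply_ne_top j)), Complex.ofReal_tsum,
    ← tsum_mul_right]
  exact tsum_congr fun i => by rw [ENNReal.toReal_mul, Complex.ofReal_mul, mul_assoc]

lemma genFun_convPow (μ : PMF ℕ) {s : ℂ} (hs : ‖s‖ ≤ 1) (k : ℕ) :
    genFun (convPow μ k) s = genFun μ s ^ k := by
  induction k with
  | zero => simpa [genFun, convPow] using tsum_pure_toReal_mul 0 (fun k => s ^ k)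
  | succ k ih =>
    have h (a : ℕ) : ∑' j, ((μ.map (fun b => a + b) j).toReal : ℂ) * s ^ j =
        s ^ a * genFun μ s := by
      rw [PMF.map, tsum_bind_toReal_mul _ _ (norm_pow_le_one_of_le hs), genFun, ← tsum_mul_left]
      refine tsum_congr fun b => ?_
      rw [Function.comp, tsum_pure_toReal_mul _ (fun j => s ^ j), pow_add]
      ring
    rw [pow_succ, ← ih, genFun, convPow, tsum_bind_toReal_mul _ _ (norm_pow_le_one_of_le hs), genFun,
      ← tsum_mul_right]
    exact tsum_congr fun a => by rw [h a, mul_assoc]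

/-! ### The law of the `n`-th generation -/

/-- The law of the `n`-th generation of a Galton-Watson process with offspring law `μ`, started
from one particle. -/
noncomputable def generationLaw (μ : PMF ℕ) : ℕ → PMF ℕ
  | 0 => PMF.pure 1
  | n + 1 => (generationLaw μ n).bind (convPow μ)

lemma genFun_generationLaw (μ : PMF ℕ) (n : ℕ) {s : ℂ} (hs : ‖s‖ ≤ 1) :
    genFun (generationLaw μ n) s = (genFun μ)^[n] s := by
  induction n generalizing s with
  | zero => simpa [genFun, generationLaw] using tsum_pure_toReal_mul 1 (fun k => s ^ k)
  | succ n ih =>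
    rw [Function.iterate_succ_apply, ← ih (norm_genFun_le_one μ hs), genFun, generationLaw,
      tsum_bind_toReal_mul _ _ (norm_pow_le_one_of_le hs), genFun]
    exact tsum_congr fun i => by rw [← genFun_convPow μ hs, genFun]

lemma measure_eq_tsum_fiber {Ω ι : Type*} [MeasurableSpace Ω] [Countable ι] [MeasurableSpace ι]
    [MeasurableSingletonClass ι] (P : Measure Ω) {W : Ω → ι} (hW : Measurable W) {A : Set Ω}
    (hA : MeasurableSet A) : P A = ∑' w, P (A ∩ W ⁻¹' {w}) := by
  rw [← measure_iUnion]
  · rw [← Set.inter_iUnion, ← Set.preimage_iUnion, Set.iUnion_of_singleton, Set.preimage_univ,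
      Set.inter_univ]
  · intro i j hij
    exact ((Set.disjoint_singleton.2 hij).preimage W).mono Set.inter_subset_right
      Set.inter_subset_right
  · exact fun w => hA.inter (hW (measurableSet_singleton w))

namespace IsGaltonWatson

variable {Ω : Type*} [MeasurableSpace Ω] {P : Measure Ω} {μ : PMF ℕ} {Z : ℕ → Ω → ℕ}

/-- The one-step transition probabilities, obtained by summing the path probabilities over the
first `n` generations. -/
lemma measure_step (hZ : IsGaltonWatson μ Z P) (n i j : ℕ) :
    P ({ω | Z n ω = i} ∩ {ω | Z (n + 1) ω = j}) = P {ω | Z n ω = i} * convPow μ i j := by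
  have hm (m k : ℕ) : MeasurableSet {ω | Z m ω = k} := hZ.measurable m (measurableSet_singleton k)
  have hW : Measurable fun ω (m : Fin n) => Z m ω := measurable_pi_lambda _ fun m => hZ.measurable m
  rw [measure_eq_tsum_fiber P hW ((hm n i).inter (hm (n + 1) j)),
    measure_eq_tsum_fiber P hW (hm n i), ← ENNReal.tsum_mul_right]
  refine tsum_congr fun w => ?_
  -- the path `w 0, …, w (n - 1), i, j`
  let z : ℕ → ℕ := fun m => if h : m < n then w ⟨m, h⟩ else if m = n then i else j
  have hlt (m : ℕ) (h : m < n) : z m = w ⟨m, h⟩ := dif_pos h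
  have hzn : z n = i := by simp [z]
  have hzn' : z (n + 1) = j := by simp [z]
  have h1 : {ω | Z n ω = i} ∩ (fun ω (m : Fin n) => Z m ω) ⁻¹' {w} =
      {ω | ∀ m ≤ n, Z m ω = z m} := by
    ext ω
    simp only [Set.mem_inter_iff, Set.mem_ofPred_eq, Set.mem_preimage, Set.mem_singleton_iff,
      funext_iff]
    constructor
    · rintro ⟨h, h'⟩ m hmn
      rcases hmn.lt_or_eq with hmn | rfl
      · rw [hlt m hmn, ← h' ⟨m, hmn⟩]
      · rw [h, hzn]
    · intro h
      exact ⟨by rw [h n le_rfl, hzn], fun m => by rw [h m m.2.le, hlt m m.2]⟩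
  have h2 : {ω | Z n ω = i} ∩ {ω | Z (n + 1) ω = j} ∩ (fun ω (m : Fin n) => Z m ω) ⁻¹' {w} =
      {ω | ∀ m ≤ n + 1, Z m ω = z m} := by
    rw [Set.inter_right_comm, h1]
    ext ω
    simp only [Set.mem_inter_iff, Set.mem_ofPred_eq]
    constructor
    · rintro ⟨h, h'⟩ m hmn
      rcases Nat.le_or_eq_of_le_succ hmn with hmn | rfl
      · exact h m hmn
      · rw [h', hzn']
    · exact fun h => ⟨fun m hmn => h m (by lia), by rw [h (n + 1) le_rfl, hzn']⟩
  rw [h1, h2, hZ.step n z, hzn, hzn']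

lemma measure_eq [IsProbabilityMeasure P] (hZ : IsGaltonWatson μ Z P) (n j : ℕ) :
    P {ω | Z n ω = j} = generationLaw μ n j := by
  induction n generalizing j with
  | zero =>
    rw [generationLaw, PMF.pure_apply]
    split_ifs with h
    · subst h
      rw [measure_congr (eventuallyEq_univ.2 hZ.init), measure_univ]
    · refine measure_eq_zero_iff_ae_notMem.2 ?_
      filter_upwards [hZ.init] with ω hω hj
      exact h (hj.symm.trans hω)
  | succ n ih =>
    rw [generationLaw, PMF.bind_apply, measure_eq_tsum_fiber P (hZ.measurable n)
      (show MeasurableSet {ω | Z (n + 1) ω = j} from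
        hZ.measurable (n + 1) (measurableSet_singleton j))]
    refine tsum_congr fun i => ?_
    rw [← ih, ← hZ.measure_step, Set.inter_comm]
    rfl

lemma integral_pow [IsProbabilityMeasure P] (hZ : IsGaltonWatson μ Z P) (n : ℕ) {s : ℂ}
    (hs : ‖s‖ ≤ 1) : ∫ ω, s ^ Z n ω ∂P = (genFun μ)^[n] s := by
  have hmap : P.map (Z n) = (generationLaw μ n).toMeasure := by
    refine Measure.ext_of_singleton fun j => ?_
    rw [Measure.map_apply (hZ.measurable n) (measurableSet_singleton j),
      PMF.toMeasure_apply_singleton _ _ (measurableSet_singleton j), ← hZ.measure_eq]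
    rfl
  have hint : Integrable (fun k : ℕ => s ^ k) (generationLaw μ n).toMeasure :=
    .of_bound (measurable_of_countable _).aestronglyMeasurable 1
      (ae_of_all _ (norm_pow_le_one_of_le hs))
  rw [← genFun_generationLaw μ n hs, genFun, ← integral_map (φ := Z n) (f := fun k : ℕ => s ^ k)
    (hZ.measurable n).aemeasurable (measurable_of_countable _).aestronglyMeasurable, hmap,
    PMF.integral_eq_tsum _ _ hint]
  exact tsum_congr fun k => by rw [Complex.real_smul]

/-- The survival probability is `1 - fₙ(0)`, with `fₙ` the `n`-th iterate of the generating
function of the offspring law. -/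
lemma measureReal_pos_eq [IsProbabilityMeasure P] (hZ : IsGaltonWatson μ Z P) (n : ℕ) :
    (P.real {ω | 0 < Z n ω} : ℂ) = 1 - (genFun μ)^[n] 0 := by
  have hm : MeasurableSet {ω | Z n ω = 0} := hZ.measurable n (measurableSet_singleton 0)
  have hc : {ω | 0 < Z n ω} = {ω | Z n ω = 0}ᶜ := by
    ext ω
    simp [Nat.pos_iff_ne_zero]
  have h0 : (fun ω => (0 : ℂ) ^ Z n ω) = {ω | Z n ω = 0}.indicator fun _ => 1 := by
    ext ω
    by_cases h : Z n ω = 0 <;> simp [h]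
  rw [← hZ.integral_pow n (by simp), h0, integral_indicator_const _ hm, hc,
    probReal_compl_eq_one_sub hm]
  simp

/-- The conditional generating function given survival. -/
lemma integral_cond_pow [IsProbabilityMeasure P] (hZ : IsGaltonWatson μ Z P) (n : ℕ)
    (hn : P.real {ω | 0 < Z n ω} ≠ 0) {s : ℂ} (hs : ‖s‖ ≤ 1) :
    ∫ ω, s ^ Z n ω ∂P[|{ω | 0 < Z n ω}] =
      1 - (1 - (genFun μ)^[n] s) / (1 - (genFun μ)^[n] 0) := by
  have hm : MeasurableSet {ω | 0 < Z n ω} := hZ.measurable n measurableSet_Ioi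
  have hint (r : ℂ) (hr : ‖r‖ ≤ 1) : Integrable (fun ω => r ^ Z n ω) P :=
    .of_bound ((measurable_of_countable fun k : ℕ => r ^ k).comp
      (hZ.measurable n)).aestronglyMeasurable 1 (ae_of_all _ fun ω => norm_pow_le_one_of_le hr _)
  have hind : {ω | 0 < Z n ω}.indicator (fun ω => s ^ Z n ω) =
      fun ω => s ^ Z n ω - 0 ^ Z n ω := by
    ext ω
    by_cases h : Z n ω = 0
    · simp [h]
    · simp [h, Nat.pos_of_ne_zero h]
  rw [ProbabilityTheory.cond, integral_smul_measure, ← integral_indicator hm, hind,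
    integral_sub (hint s hs) (hint 0 (by simp)), hZ.integral_pow n hs,
    hZ.integral_pow n (by simp), Complex.real_smul, ENNReal.toReal_inv, ← measureReal_def,
    Complex.ofReal_inv, hZ.measureReal_pos_eq n]
  have : 1 - (genFun μ)^[n] 0 ≠ 0 := by
    rw [← hZ.measureReal_pos_eq n]
    exact_mod_cast hn
  field_simp
  ring

end IsGaltonWatson

/-! ### Second-order expansion of the generating function at `1` -/

/-- The polynomial `(s ^ k - 1 - k (s - 1)) / (s - 1) ^ 2`, written without division. -/
def powRem (k : ℕ) (s : ℂ) : ℂ := ∑ j ∈ Finset.range k, ∑ i ∈ Finset.range j, s ^ i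

lemma pow_eq_add_powRem (k : ℕ) (s : ℂ) :
    s ^ k = 1 + k * (s - 1) + (s - 1) ^ 2 * powRem k s := by
  have h1 : ∑ j ∈ Finset.range k, (s ^ j - 1) = powRem k s * (s - 1) := by
    rw [powRem, Finset.sum_mul]
    exact Finset.sum_congr rfl fun j _ => (geom_sum_mul s j).symm
  have h2 := geom_sum_mul s k
  rw [Finset.sum_sub_distrib, Finset.sum_const, Finset.card_range, nsmul_eq_mul, mul_one] at h1
  linear_combination -h2 + (s - 1) * h1

lemma powRem_one (k : ℕ) : powRem k 1 = ((k * (k - 1) / 2 : ℝ) : ℂ) := by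
  induction k with
  | zero => simp [powRem]
  | succ k ih =>
    rw [powRem, Finset.sum_range_succ, ← powRem, ih]
    simp
    ring

lemma norm_powRem_le (k : ℕ) {s : ℂ} (hs : ‖s‖ ≤ 1) : ‖powRem k s‖ ≤ (k * (k - 1) / 2 : ℝ) := by
  have h : ‖powRem k s‖ ≤ ∑ j ∈ Finset.range k, ∑ i ∈ Finset.range j, (1 : ℝ) :=
    norm_sum_le_of_le _ fun j _ => norm_sum_le_of_le _ fun i _ => norm_pow_le_one_of_le hs i
  refine h.trans_eq ?_
  have h1 := powRem_one k
  simp only [powRem, one_pow] at h1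
  exact_mod_cast h1

lemma norm_one_sub_pow_le (k : ℕ) {s : ℂ} (hs : ‖s‖ ≤ 1) : ‖1 - s ^ k‖ ≤ k * ‖1 - s‖ := by
  rw [← geom_sum_mul_neg, norm_mul]
  refine mul_le_mul_of_nonneg_right ?_ (norm_nonneg _)
  simpa using norm_sum_le_of_le (Finset.range k) fun i _ => norm_pow_le_one_of_le hs i

/-- The second-order remainder `(f s - s) / (s - 1) ^ 2` of the generating function `f` of a law
with mean one, as a power series that makes sense at `s = 1` too. -/
noncomputable def genRem (μ : PMF ℕ) (s : ℂ) : ℂ := ∑' k, ((μ k).toReal : ℂ) * powRem k s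

section Moments

variable {μ : PMF ℕ} {v : ℝ}

/-- For a law with mean one and variance `v`, the second factorial moment is `v`; it is stated in
the halved form in which it bounds the coefficients of `genRem`. -/
lemma hasSum_factorialMoment (hmean : HasSum (fun k : ℕ => (k : ℝ) * (μ k).toReal) 1)
    (hvar : HasSum (fun k : ℕ => ((k : ℝ) - 1) ^ 2 * (μ k).toReal) v) :
    HasSum (fun k : ℕ => (μ k).toReal * (k * (k - 1) / 2 : ℝ)) (v / 2) := by
  have h := (hvar.add (hmean.sub μ.hasSum_toReal)).div_const 2
  rw [sub_self, add_zero] at h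
  exact h.congr_fun fun k => by ring

lemma norm_toReal_mul_powRem_le (k : ℕ) {s : ℂ} (hs : ‖s‖ ≤ 1) :
    ‖((μ k).toReal : ℂ) * powRem k s‖ ≤ (μ k).toReal * (k * (k - 1) / 2 : ℝ) := by
  rw [norm_mul, Complex.norm_real, Real.norm_of_nonneg ENNReal.toReal_nonneg]
  exact mul_le_mul_of_nonneg_left (norm_powRem_le k hs) ENNReal.toReal_nonneg

lemma genRem_one
    (hfm : HasSum (fun k : ℕ => (μ k).toReal * (k * (k - 1) / 2 : ℝ)) (v / 2)) :
    genRem μ 1 = ((v / 2 : ℝ) : ℂ) := by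
  rw [genRem, ← hfm.tsum_eq, Complex.ofReal_tsum]
  exact tsum_congr fun k => by rw [powRem_one, Complex.ofReal_mul]

lemma continuousOn_genRem
    (hfm : HasSum (fun k : ℕ => (μ k).toReal * (k * (k - 1) / 2 : ℝ)) (v / 2)) :
    ContinuousOn (genRem μ) {s | ‖s‖ ≤ 1} := by
  refine continuousOn_tsum (fun k => ?_) hfm.summable fun k s hs => norm_toReal_mul_powRem_le k hs
  unfold powRem
  fun_prop

lemma genFun_eq_add_genRem (hmean : HasSum (fun k : ℕ => (k : ℝ) * (μ k).toReal) 1)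
    (hfm : HasSum (fun k : ℕ => (μ k).toReal * (k * (k - 1) / 2 : ℝ)) (v / 2))
    {s : ℂ} (hs : ‖s‖ ≤ 1) : genFun μ s = s + (s - 1) ^ 2 * genRem μ s := by
  have h0 : HasSum (fun k => ((μ k).toReal : ℂ)) 1 := by
    simpa using Complex.hasSum_ofReal.2 μ.hasSum_toReal
  have h1 : HasSum (fun k : ℕ => (k : ℂ) * ((μ k).toReal : ℂ)) 1 := by
    simpa using Complex.hasSum_ofReal.2 hmean
  have h2 : HasSum (fun k => ((μ k).toReal : ℂ) * powRem k s) (genRem μ s) :=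
    (Summable.of_norm_bounded hfm.summable fun k => norm_toReal_mul_powRem_le k hs).hasSum
  have h := (h0.add (h1.mul_left (s - 1))).add (h2.mul_left ((s - 1) ^ 2))
  rw [genFun, ← show 1 + (s - 1) * 1 + (s - 1) ^ 2 * genRem μ s = s + (s - 1) ^ 2 * genRem μ s by
    ring, ← h.tsum_eq]
  refine tsum_congr fun k => ?_
  rw [pow_eq_add_powRem]
  ring

/-- A law with mean one has a generating function that does not increase the distance to its fixed
point `1`. -/
lemma norm_one_sub_genFun_le (hmean : HasSum (fun k : ℕ => (k : ℝ) * (μ k).toReal) 1)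
    {s : ℂ} (hs : ‖s‖ ≤ 1) : ‖1 - genFun μ s‖ ≤ ‖1 - s‖ := by
  have h0 : HasSum (fun k => ((μ k).toReal : ℂ)) 1 := by
    simpa using Complex.hasSum_ofReal.2 μ.hasSum_toReal
  have h := h0.sub (μ.summable_toReal_mul (norm_pow_le_one_of_le hs)).hasSum
  rw [← genFun] at h
  rw [← h.tsum_eq]
  have hb := hmean.mul_right ‖1 - s‖
  rw [one_mul] at hb
  refine tsum_of_norm_bounded hb fun k => ?_
  rw [← mul_one_sub, norm_mul, Complex.norm_real, Real.norm_of_nonneg ENNReal.toReal_nonneg,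
    mul_comm (k : ℝ), mul_assoc]
  exact mul_le_mul_of_nonneg_left (norm_one_sub_pow_le k hs) ENNReal.toReal_nonneg

lemma norm_iterate_genFun_le_one (μ : PMF ℕ) (n : ℕ) {s : ℂ} (hs : ‖s‖ ≤ 1) :
    ‖(genFun μ)^[n] s‖ ≤ 1 := by
  rw [← genFun_generationLaw μ n hs]
  exact norm_genFun_le_one _ hs

lemma norm_one_sub_iterate_genFun_le (hmean : HasSum (fun k : ℕ => (k : ℝ) * (μ k).toReal) 1)
    (n : ℕ) {s : ℂ} (hs : ‖s‖ ≤ 1) : ‖1 - (genFun μ)^[n] s‖ ≤ ‖1 - s‖ := by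
  induction n with
  | zero => rfl
  | succ n ih =>
    rw [Function.iterate_succ_apply']
    exact (norm_one_sub_genFun_le hmean (norm_iterate_genFun_le_one μ n hs)).trans ih

/-! ### Increments of `1 / (1 - fₙ)` -/

/-- The increment `1 / (1 - f s) - 1 / (1 - s)`, expressed by the second-order remainder of the
generating function `f` so that it extends continuously to `s = 1`. -/
noncomputable def invIncrement (μ : PMF ℕ) (s : ℂ) : ℂ :=
  genRem μ s / (1 - (1 - s) * genRem μ s)

lemma inv_one_sub_genFun (hmean : HasSum (fun k : ℕ => (k : ℝ) * (μ k).toReal) 1)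
    (hfm : HasSum (fun k : ℕ => (μ k).toReal * (k * (k - 1) / 2 : ℝ)) (v / 2))
    {s : ℂ} (hs : ‖s‖ ≤ 1) (hs1 : s ≠ 1) (hf : genFun μ s ≠ 1) :
    (1 - genFun μ s)⁻¹ = (1 - s)⁻¹ + invIncrement μ s := by
  have h1 : 1 - s ≠ 0 := sub_ne_zero.2 hs1.symm
  have h2 : 1 - genFun μ s = (1 - s) * (1 - (1 - s) * genRem μ s) := by
    rw [genFun_eq_add_genRem hmean hfm hs]
    ring
  have h3 : 1 - (1 - s) * genRem μ s ≠ 0 := by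
    intro h
    rw [h, mul_zero] at h2
    exact hf (sub_eq_zero.1 h2).symm
  rw [h2, invIncrement]
  field_simp
  ring

lemma inv_one_sub_iterate_genFun (hmean : HasSum (fun k : ℕ => (k : ℝ) * (μ k).toReal) 1)
    (hfm : HasSum (fun k : ℕ => (μ k).toReal * (k * (k - 1) / 2 : ℝ)) (v / 2))
    {s : ℂ} (hs : ‖s‖ ≤ 1) (n : ℕ) (hne : ∀ k, (genFun μ)^[k] s ≠ 1) :
    (1 - (genFun μ)^[n] s)⁻¹ - (1 - s)⁻¹ =
      ∑ k ∈ Finset.range n, invIncrement μ ((genFun μ)^[k] s) := by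
  refine (Finset.sum_range_sub (fun k => (1 - (genFun μ)^[k] s)⁻¹) n).symm.trans ?_
  refine Finset.sum_congr rfl fun k _ => ?_
  have h := hne (k + 1)
  simp only [Function.iterate_succ_apply'] at h ⊢
  rw [inv_one_sub_genFun hmean hfm (norm_iterate_genFun_le_one μ k hs) (hne k) h,
    add_sub_cancel_left]

lemma tendsto_one_sub_mul_genRem
    (hfm : HasSum (fun k : ℕ => (μ k).toReal * (k * (k - 1) / 2 : ℝ)) (v / 2)) :
    Tendsto (fun s => 1 - (1 - s) * genRem μ s) (𝓝[{s | ‖s‖ ≤ 1}] 1) (𝓝 1) := by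
  have h : ContinuousOn (fun s => 1 - (1 - s) * genRem μ s) {s | ‖s‖ ≤ 1} := by
    have := continuousOn_genRem hfm
    fun_prop
  simpa using h 1 (by simp : ‖(1 : ℂ)‖ ≤ 1) |>.tendsto

lemma tendsto_invIncrement
    (hfm : HasSum (fun k : ℕ => (μ k).toReal * (k * (k - 1) / 2 : ℝ)) (v / 2)) :
    Tendsto (invIncrement μ) (𝓝[{s | ‖s‖ ≤ 1}] 1) (𝓝 ((v / 2 : ℝ) : ℂ)) := by
  have h := (continuousOn_genRem hfm 1 (by simp : ‖(1 : ℂ)‖ ≤ 1)).tendsto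
  rw [genRem_one hfm] at h
  have h' := h.div (tendsto_one_sub_mul_genRem hfm) one_ne_zero
  rwa [div_one] at h'

/-- If the starting points `u n` in the closed unit disc tend to `1`, then the increments of
`1 / (1 - ·)` over the first `n` iterations average to `v / 2`: by
`norm_one_sub_iterate_genFun_le` the whole orbit stays as close to `1` as `u n` is, even when
`u n` approaches `1` along the unit circle. -/
lemma tendsto_inv_one_sub_iterate_of_tendsto_one
    (hmean : HasSum (fun k : ℕ => (k : ℝ) * (μ k).toReal) 1)
    (hfm : HasSum (fun k : ℕ => (μ k).toReal * (k * (k - 1) / 2 : ℝ)) (v / 2))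
    {u : ℕ → ℂ} (hu : ∀ n, ‖u n‖ ≤ 1) (hu1 : ∀ᶠ n in atTop, u n ≠ 1)
    (hlim : Tendsto u atTop (𝓝 1)) :
    Tendsto (fun n : ℕ => (n : ℂ)⁻¹ * ((1 - (genFun μ)^[n] (u n))⁻¹ - (1 - u n)⁻¹)) atTop
      (𝓝 ((v / 2 : ℝ) : ℂ)) := by
  rw [Metric.tendsto_atTop']
  intro ε hε
  have hev : ∀ᶠ s in 𝓝[{s : ℂ | ‖s‖ ≤ 1}] 1,
      1 - (1 - s) * genRem μ s ≠ 0 ∧ dist (invIncrement μ s) ((v / 2 : ℝ) : ℂ) < ε / 2 :=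
    ((tendsto_one_sub_mul_genRem hfm).eventually_ne one_ne_zero).and
      (Metric.tendsto_nhds.1 (tendsto_invIncrement hfm) _ (half_pos hε))
  obtain ⟨δ, hδ, hball⟩ := Metric.mem_nhdsWithin_iff.1 hev
  obtain ⟨N, hN⟩ := eventually_atTop.1 (hu1.and (Metric.tendsto_nhds.1 hlim δ hδ))
  refine ⟨N, fun n hn => ?_⟩
  have hn0 : 0 < n := by lia
  obtain ⟨hn1, hnδ⟩ := hN n hn.le
  have horb (k : ℕ) := hball ⟨show dist ((genFun μ)^[k] (u n)) 1 < δ by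
    rw [dist_comm, dist_eq_norm]
    refine (norm_one_sub_iterate_genFun_le hmean k (hu n)).trans_lt ?_
    rwa [← dist_eq_norm, dist_comm], norm_iterate_genFun_le_one μ k (hu n)⟩
  have hne (k : ℕ) : (genFun μ)^[k] (u n) ≠ 1 := by
    induction k with
    | zero => exact hn1
    | succ k ih =>
      rw [Function.iterate_succ_apply',
        genFun_eq_add_genRem hmean hfm (norm_iterate_genFun_le_one μ k (hu n)), ne_comm,
        ← sub_ne_zero]
      convert mul_ne_zero (sub_ne_zero.2 ih.symm) (horb k).1 using 1
      ring
  rw [inv_one_sub_iterate_genFun hmean hfm (hu n) n hne, dist_eq_norm]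
  have hnC : (n : ℂ) ≠ 0 := by exact_mod_cast hn0.ne'
  have hnR : (0 : ℝ) < n := by exact_mod_cast hn0
  have heq : (n : ℂ)⁻¹ * ∑ k ∈ Finset.range n, invIncrement μ ((genFun μ)^[k] (u n)) -
      ((v / 2 : ℝ) : ℂ) = (n : ℂ)⁻¹ * ∑ k ∈ Finset.range n,
        (invIncrement μ ((genFun μ)^[k] (u n)) - ((v / 2 : ℝ) : ℂ)) := by
    rw [Finset.sum_sub_distrib, Finset.sum_const, Finset.card_range, nsmul_eq_mul, mul_sub,
      inv_mul_cancel_left₀ hnC]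
  have hsum : ‖∑ k ∈ Finset.range n,
      (invIncrement μ ((genFun μ)^[k] (u n)) - ((v / 2 : ℝ) : ℂ))‖ ≤ n * (ε / 2) := by
    have hk (k : ℕ) : ‖invIncrement μ ((genFun μ)^[k] (u n)) - ((v / 2 : ℝ) : ℂ)‖ ≤ ε / 2 := by
      rw [← dist_eq_norm]
      exact (horb k).2.le
    refine (norm_sum_le_of_le _ fun k _ => hk k).trans_eq ?_
    simp
  rw [heq, norm_mul, norm_inv, Complex.norm_natCast]
  calc (n : ℝ)⁻¹ * _ ≤ (n : ℝ)⁻¹ * (n * (ε / 2)) := by gcongr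
    _ = ε / 2 := inv_mul_cancel_left₀ hnR.ne' _
    _ < ε := half_lt_self hε

/-! ### Almost sure extinction -/

/-- On `[0, 1)` the generating function is real with values in `[0, 1)`, and the distance to the
fixed point `1` decreases by a quadratic amount. -/
lemma exists_genFun_ofReal (hmean : HasSum (fun k : ℕ => (k : ℝ) * (μ k).toReal) 1)
    (hfm : HasSum (fun k : ℕ => (μ k).toReal * (k * (k - 1) / 2 : ℝ)) (v / 2)) (hv : 0 < v) :
    ∃ p : ℝ, 0 < p ∧ ∀ a : ℝ, 0 ≤ a → a < 1 → ∃ b : ℝ, 0 ≤ b ∧ b < 1 ∧ genFun μ a = b ∧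
      a + p * (1 - a) ^ 2 ≤ b := by
  -- the variance is positive, so some `k ≥ 2` is charged
  obtain ⟨k, hk⟩ : ∃ k : ℕ, (μ k).toReal * (k * (k - 1) / 2 : ℝ) ≠ 0 := by
    by_contra! h
    have := hfm.unique (by simpa only [h] using hasSum_zero)
    linarith
  have hk2 : 2 ≤ k := by
    by_contra! h
    interval_cases k <;> simp at hk
  have hp : 0 < (μ k).toReal := ENNReal.toReal_nonneg.lt_of_ne' (left_ne_zero_of_mul hk)
  refine ⟨(μ k).toReal, hp, fun a ha ha1 => ?_⟩
  have hnorm : ‖(a : ℂ)‖ ≤ 1 := by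
    rw [Complex.norm_real, Real.norm_of_nonneg ha]
    exact ha1.le
  let g : ℕ → ℝ := fun k => ∑ j ∈ Finset.range k, ∑ i ∈ Finset.range j, a ^ i
  have hg0 (k : ℕ) : 0 ≤ g k := Finset.sum_nonneg fun j _ => Finset.sum_nonneg fun i _ => by
    positivity
  have hgk : 1 ≤ g k := by
    have h1 : 1 ≤ ∑ i ∈ Finset.range 1, a ^ i := by simp
    exact h1.trans (Finset.single_le_sum (f := fun j => ∑ i ∈ Finset.range j, a ^ i)
      (fun j _ => Finset.sum_nonneg fun i _ => by positivity) (Finset.mem_range.2 hk2))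
  have hgC (k : ℕ) : powRem k a = (g k : ℂ) := by simp [powRem, g]
  have hsum : Summable fun k => (μ k).toReal * g k := by
    refine Complex.summable_ofReal.1 (Summable.of_norm_bounded hfm.summable fun k => ?_)
    rw [Complex.ofReal_mul, ← hgC]
    exact norm_toReal_mul_powRem_le k hnorm
  have hrem : genRem μ a = ((∑' k, (μ k).toReal * g k : ℝ) : ℂ) := by
    rw [genRem, Complex.ofReal_tsum]
    exact tsum_congr fun k => by rw [hgC, Complex.ofReal_mul]
  have hle : (μ k).toReal ≤ ∑' k, (μ k).toReal * g k :=
    (le_mul_of_one_le_right hp.le hgk).trans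
      (hsum.le_tsum k fun j _ => mul_nonneg ENNReal.toReal_nonneg (hg0 j))
  have hsumb : Summable fun j => (μ j).toReal * a ^ j :=
    .of_nonneg_of_le (fun j => by positivity)
      (fun j => mul_le_of_le_one_right ENNReal.toReal_nonneg (pow_le_one₀ ha ha1.le))
      μ.hasSum_toReal.summable
  have hb : genFun μ a = ((∑' j, (μ j).toReal * a ^ j : ℝ) : ℂ) := by
    rw [genFun, Complex.ofReal_tsum]
    exact tsum_congr fun j => by push_cast; rfl
  refine ⟨∑' j, (μ j).toReal * a ^ j, tsum_nonneg fun j => by positivity, ?_, hb, ?_⟩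
  · rw [← μ.hasSum_toReal.tsum_eq]
    exact Summable.tsum_lt_tsum_of_nonneg (i := k) (fun j => by positivity)
      (fun j => mul_le_of_le_one_right ENNReal.toReal_nonneg (pow_le_one₀ ha ha1.le))
      (mul_lt_of_lt_one_right hp (pow_lt_one₀ ha ha1 (by lia))) μ.hasSum_toReal.summable
  · have h := genFun_eq_add_genRem hmean hfm hnorm
    rw [hb, hrem] at h
    have h' : ∑' j, (μ j).toReal * a ^ j = a + (a - 1) ^ 2 * ∑' k, (μ k).toReal * g k := by
      exact_mod_cast h
    rw [h']
    nlinarith [mul_le_mul_of_nonneg_left hle (sq_nonneg (a - 1))]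

/-- The extinction probabilities `fₙ(0)` are less than one and tend to one. -/
lemma iterate_genFun_zero_ne_one_and_tendsto
    (hmean : HasSum (fun k : ℕ => (k : ℝ) * (μ k).toReal) 1)
    (hfm : HasSum (fun k : ℕ => (μ k).toReal * (k * (k - 1) / 2 : ℝ)) (v / 2)) (hv : 0 < v) :
    (∀ n, (genFun μ)^[n] 0 ≠ 1) ∧ Tendsto (fun n => (genFun μ)^[n] 0) atTop (𝓝 1) := by
  obtain ⟨p, hp, hstep⟩ := exists_genFun_ofReal hmean hfm hv
  have hex (n : ℕ) : ∃ a : ℝ, 0 ≤ a ∧ a < 1 ∧ (genFun μ)^[n] 0 = a := by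
    induction n with
    | zero => exact ⟨0, le_rfl, one_pos, by simp⟩
    | succ n ih =>
      obtain ⟨a, ha, ha1, hfa⟩ := ih
      obtain ⟨b, hb, hb1, hfb, -⟩ := hstep a ha ha1
      exact ⟨b, hb, hb1, by rw [Function.iterate_succ_apply', hfa, hfb]⟩
  choose a ha ha1 hfa using hex
  have hrec (n : ℕ) : a n + p * (1 - a n) ^ 2 ≤ a (n + 1) := by
    obtain ⟨b, -, -, hfb, hle⟩ := hstep (a n) (ha n) (ha1 n)
    have : (a (n + 1) : ℂ) = b := by rw [← hfa, Function.iterate_succ_apply', hfa, hfb]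
    rwa [Complex.ofReal_injective this]
  have hmono : Monotone a := monotone_nat_of_le_succ fun n =>
    (le_add_of_nonneg_right (by positivity)).trans (hrec n)
  have hlim := tendsto_atTop_ciSup hmono ⟨1, by rintro _ ⟨n, rfl⟩; exact (ha1 n).le⟩
  set L := ⨆ n, a n
  -- the limit `L` satisfies `L + p (1 - L) ^ 2 ≤ L`
  have hL : L + p * (1 - L) ^ 2 ≤ L :=
    le_of_tendsto_of_tendsto' (hlim.add (((tendsto_const_nhds.sub hlim).pow 2).const_mul p))
      (hlim.comp (tendsto_add_atTop_nat 1)) hrec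
  have hL1 : (1 - L) ^ 2 ≤ 0 := by
    by_contra! h
    nlinarith [mul_pos hp h]
  have hL2 : L = 1 := by
    have := pow_eq_zero_iff (two_ne_zero) |>.1 (le_antisymm hL1 (sq_nonneg _))
    linarith
  rw [hL2] at hlim
  constructor
  · intro n h
    rw [hfa] at h
    exact (ha1 n).ne (by exact_mod_cast h)
  · simp_rw [hfa]
    exact_mod_cast (Complex.continuous_ofReal.tendsto 1).comp hlim

/-- The counterpart of `tendsto_inv_one_sub_iterate_of_tendsto_one` for the orbit of `0`, which is
not close to `1` from the start but converges to it. -/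
lemma tendsto_inv_one_sub_iterate_zero
    (hmean : HasSum (fun k : ℕ => (k : ℝ) * (μ k).toReal) 1)
    (hfm : HasSum (fun k : ℕ => (μ k).toReal * (k * (k - 1) / 2 : ℝ)) (v / 2)) (hv : 0 < v) :
    Tendsto (fun n : ℕ => (n : ℂ)⁻¹ * ((1 - (genFun μ)^[n] 0)⁻¹ - (1 - 0)⁻¹)) atTop
      (𝓝 ((v / 2 : ℝ) : ℂ)) := by
  obtain ⟨hne, hlim⟩ := iterate_genFun_zero_ne_one_and_tendsto hmean hfm hv
  have h := ((tendsto_invIncrement hfm).comp (tendsto_nhdsWithin_iff.2 ⟨hlim,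
    .of_forall fun n => norm_iterate_genFun_le_one μ n (by simp)⟩)).cesaro_smul
  refine h.congr fun n => ?_
  rw [inv_one_sub_iterate_genFun hmean hfm (by simp) n hne, Complex.real_smul]
  push_cast
  rfl

end Moments

lemma tendsto_mul_one_sub_of_tendsto_inv {u w : ℕ → ℂ} {c L : ℂ} (hcL : c + L ≠ 0)
    (h : Tendsto (fun n : ℕ => (n : ℂ)⁻¹ * ((1 - w n)⁻¹ - (1 - u n)⁻¹)) atTop (𝓝 L))
    (hu : Tendsto (fun n : ℕ => (n : ℂ)⁻¹ * (1 - u n)⁻¹) atTop (𝓝 c)) :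
    Tendsto (fun n : ℕ => (n : ℂ) * (1 - w n)) atTop (𝓝 (c + L)⁻¹) := by
  refine ((hu.add h).inv₀ hcL).congr fun n => ?_
  rw [← mul_add, add_sub_cancel, mul_inv, inv_inv, inv_inv]

/-- `1 - fₙ(0)` is asymptotic to `2 / (n v)`. -/
lemma tendsto_mul_one_sub_iterate_zero {μ : PMF ℕ} {v : ℝ}
    (hmean : HasSum (fun k : ℕ => (k : ℝ) * (μ k).toReal) 1)
    (hfm : HasSum (fun k : ℕ => (μ k).toReal * (k * (k - 1) / 2 : ℝ)) (v / 2)) (hv : 0 < v) :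
    Tendsto (fun n : ℕ => (n : ℂ) * (1 - (genFun μ)^[n] 0)) atTop (𝓝 ((v / 2 : ℝ) : ℂ)⁻¹) := by
  have hL : ((v / 2 : ℝ) : ℂ) ≠ 0 := Complex.ofReal_ne_zero.2 (half_pos hv).ne'
  have h := tendsto_mul_one_sub_of_tendsto_inv (c := 0) (by rwa [zero_add])
    (tendsto_inv_one_sub_iterate_zero hmean hfm hv)
    (by simpa using tendsto_inv_atTop_nhds_zero_nat (𝕜 := ℂ))
  rwa [zero_add] at h

/-! ### Characteristic functions -/

lemma charFun_expMeasure {r : ℝ} (hr : 0 < r) (t : ℝ) :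
    charFun (expMeasure r) t = r / (r - t * Complex.I) := by
  have hfin : ∀ᵐ x, exponentialPDF r x < ⊤ := ae_of_all _ fun x => ENNReal.ofReal_lt_top
  have hmeas : Measurable (exponentialPDF r) := (measurable_exponentialPDFReal r).ennreal_ofReal
  have hexp : expMeasure r = volume.withDensity (exponentialPDF r) := rfl
  rw [charFun_apply_real, hexp, integral_withDensity_eq_integral_toReal_smul hmeas hfin]
  have hind : (fun x : ℝ => (exponentialPDF r x).toReal • Complex.exp (t * x * Complex.I)) =
      (Set.Ici (0 : ℝ)).indicator
        fun x : ℝ => (r : ℂ) * Complex.exp ((-(r - t * Complex.I)) * x) := by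
    ext x
    by_cases hx : 0 ≤ x
    · rw [Set.indicator_of_mem (Set.mem_Ici.2 hx), exponentialPDF_of_nonneg hx,
        ENNReal.toReal_ofReal (by positivity), Complex.real_smul]
      push_cast
      rw [mul_assoc, ← Complex.exp_add]
      ring_nf
    · rw [Set.indicator_of_notMem (by simpa using hx), exponentialPDF_of_neg (not_le.1 hx)]
      simp
  rw [hind, integral_indicator measurableSet_Ici, integral_Ici_eq_integral_Ioi,
    integral_const_mul, integral_exp_mul_complex_Ioi (by simpa using hr)]
  simp only [Complex.ofReal_zero, mul_zero, Complex.exp_zero, neg_div_neg_eq]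
  rw [mul_one_div]

lemma tendsto_natCast_mul_one_sub_exp_div (c : ℂ) :
    Tendsto (fun n : ℕ => (n : ℂ) * (1 - Complex.exp (c / n))) atTop (𝓝 (-c)) := by
  have hd : HasDerivAt (fun x : ℂ => 1 - Complex.exp (c * x)) (-c) 0 := by
    simpa using (((hasDerivAt_id (0 : ℂ)).const_mul c).cexp).const_sub 1
  have hinv : Tendsto (fun n : ℕ => (n : ℂ)⁻¹) atTop (𝓝[≠] 0) :=
    tendsto_nhdsWithin_iff.2 ⟨tendsto_inv_atTop_nhds_zero_nat,
      (eventually_ne_atTop 0).mono fun n hn => by simpa using hn⟩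
  refine (hd.tendsto_slope_zero.comp hinv).congr fun n => ?_
  simp [div_eq_mul_inv]

lemma norm_exp_mul_I_div_natCast (t : ℝ) (n : ℕ) : ‖Complex.exp (t * Complex.I / n)‖ = 1 := by
  have : (t * Complex.I / n : ℂ) = ((t / n : ℝ) : ℂ) * Complex.I := by
    push_cast
    ring
  rw [this, Complex.norm_exp_ofReal_mul_I]

/-- The algebra behind the exponential limit: `c = t i` is the limit of `-n (1 - exp (t i / n))`,
and `L⁻¹ / (L⁻¹ - t i)` is the characteristic function of the exponential law with mean `L`. -/
lemma one_sub_inv_div_inv {c L : ℂ} (hc : c ≠ 0) (hL : L ≠ 0) (h : L⁻¹ - c ≠ 0) :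
    (-c)⁻¹ + L ≠ 0 ∧ 1 - ((-c)⁻¹ + L)⁻¹ / L⁻¹ = L⁻¹ / (L⁻¹ - c) := by
  have key : (-c)⁻¹ + L = -(L / c) * (L⁻¹ - c) := by
    have h1 : L / c * L⁻¹ = c⁻¹ := by field_simp
    have h2 : L / c * c = L := div_mul_cancel₀ L hc
    rw [inv_neg, mul_sub, neg_mul, neg_mul, h1, h2, sub_neg_eq_add]
  rw [key]
  refine ⟨mul_ne_zero (neg_ne_zero.2 (div_ne_zero hL hc)) h, ?_⟩
  have h3 : (-(L / c) * (L⁻¹ - c))⁻¹ / L⁻¹ = -c / (L⁻¹ - c) := by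
    rw [mul_inv, inv_neg, inv_div, div_inv_eq_mul, div_eq_mul_inv (-c)]
    have h4 : c / L * L = c := div_mul_cancel₀ c hL
    linear_combination -(L⁻¹ - c)⁻¹ * h4
  rw [h3, one_sub_div h]
  ring

namespace IsGaltonWatson

variable {Ω : Type*} [MeasurableSpace Ω] {P : Measure Ω} [IsProbabilityMeasure P] {μ : PMF ℕ}
  {v : ℝ} {Z : ℕ → Ω → ℕ}

lemma charFun_map_cond (hZ : IsGaltonWatson μ Z P) (n : ℕ)
    (hn : P.real {ω | 0 < Z n ω} ≠ 0) (t : ℝ) :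
    charFun ((P[|{ω | 0 < Z n ω}]).map fun ω => (Z n ω : ℝ) / n) t =
      1 - (1 - (genFun μ)^[n] (Complex.exp (t * Complex.I / n))) / (1 - (genFun μ)^[n] 0) := by
  have hmeas : Measurable fun ω => (Z n ω : ℝ) / n :=
    (measurable_from_top.comp (hZ.measurable n)).div_const _
  rw [charFun_apply_real, integral_map hmeas.aemeasurable (by fun_prop),
    ← hZ.integral_cond_pow n hn (norm_exp_mul_I_div_natCast t n).le]
  refine integral_congr_ae (ae_of_all _ fun ω => ?_)
  simp only
  rw [← Complex.exp_nat_mul]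
  push_cast
  ring_nf

/-- A critical process with finite variance survives `n` generations with positive probability,
and this probability is asymptotic to `2 / (n v)` (**Kolmogorov's theorem**). -/
lemma tendsto_natCast_mul_survival (hZ : IsGaltonWatson μ Z P)
    (hmean : HasSum (fun k : ℕ => (k : ℝ) * (μ k).toReal) 1)
    (hfm : HasSum (fun k : ℕ => (μ k).toReal * (k * (k - 1) / 2 : ℝ)) (v / 2)) (hv : 0 < v) :
    (∀ n, P.real {ω | 0 < Z n ω} ≠ 0) ∧
      Tendsto (fun n : ℕ => (n : ℝ) * P.real {ω | 0 < Z n ω}) atTop (𝓝 (2 / v)) := by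
  constructor
  · intro n h
    have h1 := hZ.measureReal_pos_eq n
    rw [h, Complex.ofReal_zero, eq_comm, sub_eq_zero] at h1
    exact (iterate_genFun_zero_ne_one_and_tendsto hmean hfm hv).1 n h1.symm
  · have h := tendsto_mul_one_sub_iterate_zero hmean hfm hv
    simp_rw [← hZ.measureReal_pos_eq] at h
    rw [← Complex.ofReal_inv, inv_div] at h
    simpa [Function.comp_def] using (Complex.continuous_re.tendsto _).comp h

/-- The characteristic functions of `Z n / n` given survival converge to that of the exponential
law with mean `v / 2`. -/
lemma tendsto_charFun_map_cond (hZ : IsGaltonWatson μ Z P)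
    (hmean : HasSum (fun k : ℕ => (k : ℝ) * (μ k).toReal) 1)
    (hfm : HasSum (fun k : ℕ => (μ k).toReal * (k * (k - 1) / 2 : ℝ)) (v / 2)) (hv : 0 < v)
    (t : ℝ) :
    Tendsto (fun n : ℕ => charFun ((P[|{ω | 0 < Z n ω}]).map fun ω => (Z n ω : ℝ) / n) t) atTop
      (𝓝 (charFun (expMeasure (v / 2)⁻¹) t)) := by
  obtain ⟨hpos, -⟩ := hZ.tendsto_natCast_mul_survival hmean hfm hv
  have hLpos : 0 < v / 2 := half_pos hv
  have hL : ((v / 2 : ℝ) : ℂ) ≠ 0 := Complex.ofReal_ne_zero.2 hLpos.ne'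
  simp_rw [fun n => hZ.charFun_map_cond n (hpos n) t]
  rw [charFun_expMeasure (inv_pos.2 hLpos)]
  rcases eq_or_ne t 0 with rfl | ht
  · -- every term equals `1`, the value of a characteristic function at `0`
    have h1 (n : ℕ) : (genFun μ)^[n] 1 = 1 := by
      rw [← hZ.integral_pow n (by simp)]
      simp
    have hL' : ((v / 2 : ℝ) : ℂ)⁻¹ ≠ 0 := inv_ne_zero hL
    simp only [Complex.ofReal_zero, zero_mul, zero_div, Complex.exp_zero, h1, sub_self, sub_zero,
      Complex.ofReal_inv, div_self hL']
    exact tendsto_const_nhds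
  set L : ℂ := ((v / 2 : ℝ) : ℂ) with hLdef
  have hc : (t * Complex.I : ℂ) ≠ 0 := mul_ne_zero (Complex.ofReal_ne_zero.2 ht) Complex.I_ne_zero
  set u : ℕ → ℂ := fun n => Complex.exp (t * Complex.I / n) with hu
  have hunorm (n : ℕ) : ‖u n‖ ≤ 1 := (norm_exp_mul_I_div_natCast t n).le
  have hulim : Tendsto u atTop (𝓝 1) := by
    have := (tendsto_inv_atTop_nhds_zero_nat (𝕜 := ℂ)).const_mul (t * Complex.I)
    simpa [hu, div_eq_mul_inv] using this.cexp
  have hn1 := tendsto_natCast_mul_one_sub_exp_div (t * Complex.I)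
  have hu1 : ∀ᶠ n in atTop, u n ≠ 1 := by
    filter_upwards [hn1.eventually_ne (neg_ne_zero.2 hc)] with n hn h
    simp [hu] at h
    simp [h] at hn
  -- `1 / (n (1 - fₙ(uₙ)))` tends to the limit of `1 / (n (1 - uₙ))` plus the limit `L` of the
  -- averaged increments
  have hinv : Tendsto (fun n : ℕ => (n : ℂ)⁻¹ * (1 - u n)⁻¹) atTop (𝓝 (-(t * Complex.I))⁻¹) :=
    (hn1.inv₀ (neg_ne_zero.2 hc)).congr fun n => by rw [mul_inv]
  have hd : L⁻¹ - t * Complex.I ≠ 0 := by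
    intro h
    have := congrArg Complex.re h
    rw [hLdef, ← Complex.ofReal_inv] at this
    simp at this
    exact hv.ne' this
  obtain ⟨hcL, hval⟩ := one_sub_inv_div_inv hc hL hd
  have hnum := tendsto_mul_one_sub_of_tendsto_inv hcL
    (tendsto_inv_one_sub_iterate_of_tendsto_one hmean hfm hunorm hu1 hulim) hinv
  have hden := tendsto_mul_one_sub_iterate_zero hmean hfm hv
  have h := (hnum.div hden (inv_ne_zero hL)).const_sub 1
  rw [Complex.ofReal_inv, ← hLdef, ← hval]
  refine h.congr' ?_
  filter_upwards [eventually_ne_atTop 0] with n hn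
  simp only [Pi.div_apply]
  rw [mul_div_mul_left _ _ (Nat.cast_ne_zero.2 hn)]

end IsGaltonWatson

theorem theorem1p1 {Ω Ω' : Type*} [MeasurableSpace Ω] [MeasurableSpace Ω']
    (P : Measure Ω) [IsProbabilityMeasure P] (P' : Measure Ω') [IsProbabilityMeasure P']
    (μ : PMF ℕ) (σ : ℝ)
    (hmean : HasSum (fun k : ℕ => (k : ℝ) * (μ k).toReal) 1)
    (hvar : HasSum (fun k : ℕ => ((k : ℝ) - 1) ^ 2 * (μ k).toReal) (σ ^ 2))
    (hσ : 0 < σ ^ 2)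
    (Z : ℕ → Ω → ℕ) (hZ : IsGaltonWatson μ Z P)
    (Y : Ω' → ℝ) (hY : HasLaw Y (expMeasure (σ ^ 2 / 2)⁻¹) P') :
    Tendsto (fun n : ℕ => (n : ℝ) * P.real {ω | 0 < Z n ω}) atTop (𝓝 (2 / σ ^ 2)) ∧
    ∃ _ : ∀ n : ℕ, IsProbabilityMeasure (P[|{ω | 0 < Z n ω}]),
      TendstoInDistribution (fun (n : ℕ) (ω : Ω) => (Z n ω : ℝ) / (n : ℝ)) atTop Y
        (fun n : ℕ => P[|{ω | 0 < Z n ω}]) P' := by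
  have hfm := hasSum_factorialMoment hmean hvar
  obtain ⟨hpos, hlim⟩ := hZ.tendsto_natCast_mul_survival hmean hfm hσ
  have hprob (n : ℕ) : IsProbabilityMeasure (P[|{ω | 0 < Z n ω}]) :=
    cond_isProbabilityMeasure fun h => hpos n (by simp [measureReal_def, h])
  refine ⟨hlim, hprob, fun n =>
    ((measurable_from_top.comp (hZ.measurable n)).div_const _).aemeasurable,
    hY.aemeasurable, ?_⟩
  refine ProbabilityMeasure.tendsto_of_tendsto_charFun fun t => ?_
  simp only [ProbabilityMeasure.coe_mk, hY.map_eq]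
  exact hZ.tendsto_charFun_map_cond hmean hfm hσ t
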